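/- For $x,p,q\in\mathbb{R}^n$ let the comparison of $x$ with the pair $(p,q)$ be $\operatorname{sign}(\|x-q\|^2-\|x-p\|^2)$, that is, $+1$ if $x$ is closer to $p$ and $-1$ if $x$ is closer to $q$; the value at a tie may be fixed in any way. For every $\kappa>1$ there is a constant $C>0$, depending only on $\kappa$, such that the following holds. Let $n\ge 1$ and $m\ge 0$ be integers and let $R,\epsilon,\eta>0$ be reals with $R\sqrt n/\epsilon\ge\kappa$. Draw $p_1,\dots,p_m,q_1,\dots,q_m$ independently from the Gaussian distribution $\mathcal{N}(0,\sigma^2 I)$ on $\mathbb{R}^n$, where $\sigma^2=2R^2/n$. If $$m\ \ge\ C\,\frac{R}{\epsilon}\left(n\log\frac{R\sqrt n}{\epsilon}+\log\frac1\eta\right),$$ then with probability at least $1-\eta$ the following holds simultaneously for all $x,y$ in the closed Euclidean ball of radius $R$ centred at $0$: if $x$ and $y$ have the same comparison with $(p_i,q_i)$ for every $i=1,\dots,m$, then $\|x-y\|\le\epsilon$. -/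

import Mathlib

open MeasureTheory ProbabilityTheory
open scoped ENNReal

/-- The sign of a real number, `+1` if `r > 0` and `-1` if `r < 0`, where the value at `r = 0`
is the prescribed `tie` (`tie = 0` gives the usual sign function). -/
noncomputable def signWithTie (tie : SignType) (r : ℝ) : SignType :=
  if r = 0 then tie else SignType.sign r

/-- The comparison of `x` with the pair of landmarks `(p, q)`: the sign of
`‖x - q‖² - ‖x - p‖²`, i.e. `+1` if `x` is closer to `p` and `-1` if `x` is closer to `q`. -/
noncomputable def comparison {n : ℕ} (tie : SignType) (p q x : EuclideanSpace ℝ (Fin n)) :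
    SignType :=
  signWithTie tie (‖x - q‖ ^ 2 - ‖x - p‖ ^ 2)

/-- The vector of the `m` comparisons of `x` with the pairs `(p i, q i)`. -/
noncomputable def comparisons {n m : ℕ} (tie : SignType)
    (p q : Fin m → EuclideanSpace ℝ (Fin n)) (x : EuclideanSpace ℝ (Fin n)) : Fin m → SignType :=
  fun i => comparison tie (p i) (q i) x

/-- The law `N(0, v I)` on `ℝⁿ`: centred Gaussian with covariance matrix `v` times the identity. -/
noncomputable def isotropicGaussian (n : ℕ) (v : ℝ) : Measure (EuclideanSpace ℝ (Fin n)) :=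
  multivariateGaussian 0 (v • (1 : Matrix (Fin n) (Fin n) ℝ))

/-! A comparison records the side of the bisecting hyperplane of `(p, q)` on which `x` lies. Put `h
= (p + q) / √2` and `g = (q - p) / √2`: these are again independent with law `N(0, v I)`, `v =
2R²/n`, and the hyperplane is `⟪x, g⟫ = ⟪g, h⟫ / √2`.

Fix `a, b` in the ball with `‖a - b‖ ≥ ε / 2`. With probability bounded below, `g` is typical: `‖g‖`
is of order `R`, `⟪a, g⟫` and `⟪b, g⟫` are `O(R²/√n)`, and `⟪b - a, g⟫ > √v ‖b - a‖`, which is at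
least of order `εR/√n`. Given such a `g`, `⟪g, h⟫` is Gaussian with deviation of order `R²/√n`, so
it falls between `√2⟪a, g⟫` and `√2⟪b, g⟫` with probability at least of order `ε/R`. Balls of radius
`δ` of order `ε/√n` around `a` and `b` only shrink that interval by a fraction, so they are
separated as well (`exists_isotropicGaussian_prod_separatingPairs_ge`).

A `δ`-net of the ball has log-cardinality `O(n log(R√n/ε))` when `ε < 2R`. A union bound over pairs
of net points (`card_sq_mul_one_sub_pow_le`) makes all distant pairs separated at once, and the
margin `δ` carries this over to all `x, y` (`norm_sub_le_of_comparisons_eq`). -/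

/-! ### One-dimensional Gaussian estimates -/

/-- A lower bound for the Gaussian mass of an interval contained in `[-M, M]`. -/
lemma gaussianReal_Ioo_ge {w : NNReal} (hw : w ≠ 0) {l u M : ℝ} (hlu : l ≤ u)
    (hl : -M ≤ l) (hu : u ≤ M) :
    (u - l) * ((√(2 * Real.pi * w))⁻¹ * Real.exp (-M ^ 2 / (2 * w))) ≤
      (gaussianReal 0 w).real (Set.Ioo l u) := by
  rw [measureReal_def, gaussianReal_apply_eq_integral _ hw, ENNReal.toReal_ofReal
    (integral_nonneg fun x => gaussianPDFReal_nonneg _ _ _)]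
  have hconst : (u - l) * ((√(2 * Real.pi * w))⁻¹ * Real.exp (-M ^ 2 / (2 * w))) =
      ∫ _ in Set.Ioo l u, (√(2 * Real.pi * w))⁻¹ * Real.exp (-M ^ 2 / (2 * w)) := by
    simp [measureReal_def, Real.volume_Ioo, ENNReal.toReal_ofReal (sub_nonneg.2 hlu)]
  rw [hconst]
  refine setIntegral_mono_on (integrableOn_const measure_Ioo_lt_top.ne) (integrable_gaussianPDFReal _ _).integrableOn
    measurableSet_Ioo fun x hx => ?_
  rw [gaussianPDFReal_def]
  have hx2 : (x - 0) ^ 2 ≤ M ^ 2 := by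
    rw [sub_zero]
    exact sq_le_sq' (hl.trans hx.1.le) (hx.2.le.trans hu)
  simp only
  gcongr

/-- An upper bound for the Gaussian mass of a symmetric interval. -/
lemma gaussianReal_Ioo_le {w : NNReal} (hw : w ≠ 0) {t : ℝ} (ht : 0 ≤ t) :
    (gaussianReal 0 w).real (Set.Ioo (-t) t) ≤ 2 * t * (√(2 * Real.pi * w))⁻¹ := by
  rw [measureReal_def, gaussianReal_apply_eq_integral _ hw, ENNReal.toReal_ofReal
    (integral_nonneg fun x => gaussianPDFReal_nonneg _ _ _)]
  have hconst : 2 * t * (√(2 * Real.pi * w))⁻¹ =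
      ∫ _ in Set.Ioo (-t) t, (√(2 * Real.pi * w))⁻¹ := by
    simp [measureReal_def, Real.volume_Ioo, ENNReal.toReal_ofReal (by linarith : 0 ≤ t + t)]
    ring_nf; simp
  rw [hconst]
  refine setIntegral_mono_on (integrable_gaussianPDFReal _ _).integrableOn (integrableOn_const measure_Ioo_lt_top.ne)
    measurableSet_Ioo fun x hx => ?_
  rw [gaussianPDFReal_def]
  refine mul_le_of_le_one_right (by positivity) (Real.exp_le_one_iff.2 ?_)
  rw [neg_div]
  exact neg_nonpos.2 (by positivity)

/-- Chebyshev's inequality for a centred real Gaussian measure. -/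
lemma gaussianReal_abs_ge_le (w : NNReal) {c : ℝ} (hc : 0 < c) :
    (gaussianReal 0 w).real {x | c ≤ |x|} ≤ w / c ^ 2 := by
  have h := meas_ge_le_variance_div_sq (μ := gaussianReal 0 w) (X := id)
    IsGaussian.memLp_two_id hc
  rw [variance_id_gaussianReal] at h
  simp only [id_eq, integral_id_gaussianReal, sub_zero] at h
  exact ENNReal.toReal_le_of_le_ofReal (by positivity) h

/-! ### The isotropic Gaussian measure -/

section isotropicGaussian

variable {n : ℕ} {v : ℝ}

instance isGaussian_isotropicGaussian : IsGaussian (isotropicGaussian n v) := by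
  unfold isotropicGaussian; infer_instance

lemma integral_id_isotropicGaussian : (isotropicGaussian n v)[id] = 0 := by
  simp [isotropicGaussian]

/-- The marginal of the isotropic Gaussian measure in the direction `a`. -/
lemma isotropicGaussian_map_inner (hv : 0 ≤ v) (a : EuclideanSpace ℝ (Fin n)) :
    (isotropicGaussian n v).map (fun g => inner ℝ a g) =
      gaussianReal 0 (v * ‖a‖ ^ 2).toNNReal := by
  have h := IsGaussian.map_eq_gaussianReal (μ := isotropicGaussian n v) (innerSL ℝ a)
  have hpos : (v • (1 : Matrix (Fin n) (Fin n) ℝ)).PosSemidef := Matrix.PosSemidef.one.smul hv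
  have hmean : (isotropicGaussian n v)[innerSL ℝ a] = 0 := by
    rw [ContinuousLinearMap.integral_comp_id_comm IsGaussian.integrable_id,
      show ∫ x, x ∂(isotropicGaussian n v) = 0 from integral_id_isotropicGaussian, map_zero]
  have hvar : Var[innerSL ℝ a; isotropicGaussian n v] = v * ‖a‖ ^ 2 := by
    have h2 := covarianceBilin_self (μ := isotropicGaussian n v) IsGaussian.memLp_two_id a
    rw [isotropicGaussian, covarianceBilin_multivariateGaussian hpos] at h2
    have h3 : (WithLp.ofLp a) ⬝ᵥ (v • (1 : Matrix (Fin n) (Fin n) ℝ)).mulVec (WithLp.ofLp a) =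
        v * ‖a‖ ^ 2 := by
      rw [Matrix.smul_mulVec, Matrix.one_mulVec, dotProduct_smul, EuclideanSpace.real_norm_sq_eq]
      simp [dotProduct, sq]
    rw [← h3, h2]
    rfl
  rw [hmean, hvar] at h
  exact h

lemma isotropicGaussian_real_preimage_inner (hv : 0 ≤ v) (a : EuclideanSpace ℝ (Fin n))
    {s : Set ℝ} (hs : MeasurableSet s) :
    (isotropicGaussian n v).real {g | inner ℝ a g ∈ s} =
      (gaussianReal 0 (v * ‖a‖ ^ 2).toNNReal).real s := by
  rw [← isotropicGaussian_map_inner hv, map_measureReal_apply (by fun_prop) hs]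
  rfl

lemma isotropicGaussian_map_eval (hv : 0 ≤ v) (i : Fin n) :
    (isotropicGaussian n v).map (fun g => g i) = gaussianReal 0 v.toNNReal := by
  have h := isotropicGaussian_map_inner hv (EuclideanSpace.single i (1 : ℝ))
  simpa [EuclideanSpace.inner_single_left] using h

/-- Chebyshev's inequality for a marginal of the isotropic Gaussian measure. -/
lemma isotropicGaussian_abs_inner_ge_le (hv : 0 ≤ v) (a : EuclideanSpace ℝ (Fin n)) {c : ℝ}
    (hc : 0 < c) :
    (isotropicGaussian n v).real {g | c ≤ |inner ℝ a g|} ≤ v * ‖a‖ ^ 2 / c ^ 2 := by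
  have h := isotropicGaussian_real_preimage_inner hv a
    (measurableSet_le measurable_const measurable_id.abs : MeasurableSet {x : ℝ | c ≤ |x|})
  simp only [Set.mem_ofPred_eq] at h
  rw [h]
  refine (gaussianReal_abs_ge_le _ hc).trans_eq ?_
  rw [Real.coe_toNNReal _ (by positivity)]

/-- The marginal in the direction `a` exceeds its standard deviation with a probability bounded
below by an absolute constant. -/
lemma isotropicGaussian_inner_gt_ge (hv : 0 < v) {a : EuclideanSpace ℝ (Fin n)} (ha : a ≠ 0) :
    (√(2 * Real.pi))⁻¹ * Real.exp (-2) ≤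
      (isotropicGaussian n v).real {g | √v * ‖a‖ < inner ℝ a g} := by
  have hs : 0 < √v * ‖a‖ := by positivity
  have hw : (v * ‖a‖ ^ 2).toNNReal ≠ 0 := by
    simp only [ne_eq, Real.toNNReal_eq_zero, not_le]; positivity
  have hsq : v * ‖a‖ ^ 2 = (√v * ‖a‖) ^ 2 := by rw [mul_pow, Real.sq_sqrt hv.le]
  -- The interval from one to two standard deviations; with `M` equal to two deviations the exponent
  -- is `-2`.
  have h := gaussianReal_Ioo_ge hw (l := √v * ‖a‖) (u := 2 * (√v * ‖a‖))
    (M := 2 * (√v * ‖a‖)) (by linarith) (by linarith) le_rfl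
  rw [← isotropicGaussian_real_preimage_inner hv.le a measurableSet_Ioo,
    Real.coe_toNNReal _ (by positivity), hsq, Real.sqrt_mul (by positivity),
    Real.sqrt_sq hs.le] at h
  refine le_trans (le_of_eq ?_) (h.trans (measureReal_mono fun g hg => hg.1))
  rw [show -(2 * (√v * ‖a‖)) ^ 2 / (2 * (√v * ‖a‖) ^ 2) = -2 by field_simp]
  field_simp
  ring

/-- Markov's inequality for the norm. -/
lemma isotropicGaussian_norm_ge_le (hv : 0 ≤ v) {c : ℝ} (hc : 0 < c) :
    (isotropicGaussian n v).real {g | c ≤ ‖g‖} ≤ n * v / c ^ 2 := by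
  have hsq (i : Fin n) : ∫⁻ g, ENNReal.ofReal (g i ^ 2) ∂(isotropicGaussian n v) =
      ENNReal.ofReal v := by
    have h1 : ∫⁻ g, ENNReal.ofReal (g i ^ 2) ∂(isotropicGaussian n v) =
        ∫⁻ x, ENNReal.ofReal (x ^ 2) ∂(gaussianReal 0 v.toNNReal) := by
      rw [← isotropicGaussian_map_eval hv i, lintegral_map (by fun_prop) (by fun_prop)]
    have h2 : ∫ x, x ^ 2 ∂(gaussianReal 0 v.toNNReal) = v := by
      have h3 := variance_id_gaussianReal (μ := 0) (v := v.toNNReal)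
      rw [variance_eq_integral aemeasurable_id] at h3
      simpa [hv] using h3
    rw [h1, ← h2, ofReal_integral_eq_lintegral_ofReal _ (ae_of_all _ fun x => sq_nonneg x), h2]
    exact IsGaussian.memLp_two_id.integrable_sq
  have hint : ∫⁻ g, ENNReal.ofReal (‖g‖ ^ 2) ∂(isotropicGaussian n v) =
      ENNReal.ofReal (n * v) := by
    simp_rw [EuclideanSpace.real_norm_sq_eq,
      ENNReal.ofReal_sum_of_nonneg fun i _ => sq_nonneg _]
    rw [lintegral_finsetSum _ (by fun_prop)]
    simp_rw [hsq]
    simp [ENNReal.ofReal_mul]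
  have h := meas_ge_le_lintegral_div (μ := isotropicGaussian n v)
    (f := fun g => ENNReal.ofReal (‖g‖ ^ 2)) (by fun_prop) (ε := ENNReal.ofReal (c ^ 2))
    (by simpa using hc.ne') (by simp)
  rw [hint, ← ENNReal.ofReal_div_of_pos (by positivity)] at h
  refine ENNReal.toReal_le_of_le_ofReal (by positivity) (le_trans (measure_mono fun g hg => ?_) h)
  exact ENNReal.ofReal_le_ofReal (by gcongr; exact hg)

/-- A small ball estimate: if `‖g‖² < c² n v`, then at least half of the coordinates of `g` are
smaller than `√2 c √v`. -/
lemma isotropicGaussian_norm_lt_le (hn : 1 ≤ n) (hv : 0 < v) {c : ℝ} (hc : 0 < c) :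
    (isotropicGaussian n v).real {g | ‖g‖ < c * √(n * v)} ≤ 4 * c := by
  have hn' : (0 : ℝ) < n := by exact_mod_cast hn
  -- With `t² = 2c²v`, a set of `n / 2` coordinates of size at least `t` already forces `‖g‖² ≥ c² n
  -- v`.
  set t := √2 * c * √v with ht_def
  have ht : 0 < t := by positivity
  have ht2 : t ^ 2 = 2 * c ^ 2 * v := by
    rw [ht_def, mul_pow, mul_pow, Real.sq_sqrt (by norm_num), Real.sq_sqrt hv.le]
  set ρ := (gaussianReal 0 v.toNNReal).real (Set.Ioo (-t) t) with hρ
  have hρle : ρ ≤ 2 * c := by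
    refine (gaussianReal_Ioo_le (by simpa using hv) ht.le).trans ?_
    rw [Real.coe_toNNReal _ hv.le, Real.sqrt_mul (by positivity), ht_def,
      Real.sqrt_mul (by norm_num)]
    have hpi : 1 ≤ √Real.pi := Real.one_le_sqrt.2 (by linarith [Real.pi_gt_three])
    have : 2 * (√2 * c * √v) * (√2 * √Real.pi * √v)⁻¹ = 2 * c / √Real.pi := by
      field_simp
    rw [this]
    exact div_le_self (by positivity) hpi
  have hcoord (i : Fin n) : isotropicGaussian n v {g | g i ∈ Set.Ioo (-t) t} =
      ENNReal.ofReal ρ := by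
    rw [hρ, measureReal_def, ENNReal.ofReal_toReal (measure_ne_top _ _),
      ← isotropicGaussian_map_eval hv.le i, Measure.map_apply (by fun_prop) measurableSet_Ioo]
    rfl
  have hmeas (i : Fin n) :
      MeasurableSet {g : EuclideanSpace ℝ (Fin n) | g i ∈ Set.Ioo (-t) t} :=
    measurableSet_Ioo.preimage (by fun_prop)
  have hint : ∫⁻ g, ∑ i : Fin n, Set.indicator {g : EuclideanSpace ℝ (Fin n) |
      g i ∈ Set.Ioo (-t) t} (fun _ => (1 : ℝ≥0∞)) g ∂(isotropicGaussian n v) =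
      ENNReal.ofReal (n * ρ) := by
    rw [lintegral_finsetSum _ fun i _ => measurable_const.indicator (hmeas i)]
    simp_rw [lintegral_indicator_const (hmeas _), hcoord]
    simp [ENNReal.ofReal_mul]
  -- Markov's inequality for the number of coordinates in `(-t, t)`, at level `n / 2`; its mean is
  -- `n ρ`. No independence of coordinates is needed.
  have h := meas_ge_le_lintegral_div (μ := isotropicGaussian n v)
    (f := fun g => ∑ i : Fin n, Set.indicator {g : EuclideanSpace ℝ (Fin n) |
      g i ∈ Set.Ioo (-t) t} (fun _ => (1 : ℝ≥0∞)) g)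
    (Finset.measurable_sum _ fun i _ => measurable_const.indicator (hmeas i)).aemeasurable
    (ε := ENNReal.ofReal (n / 2)) (by simpa using hn') (by simp)
  rw [hint, ← ENNReal.ofReal_div_of_pos (by positivity)] at h
  have hbound : n * ρ / (n / 2) ≤ 4 * c := by
    rw [show n * ρ / (n / 2) = 2 * ρ by field_simp]
    linarith
  refine (ENNReal.toReal_le_of_le_ofReal (by positivity)
    (le_trans (measure_mono fun g hg => ?_) h)).trans hbound
  rw [Set.mem_ofPred_eq] at hg ⊢
  classical
  set A := Finset.univ.filter fun i : Fin n => g i ∈ Set.Ioo (-t) t with hA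
  have hsum : ∑ i : Fin n, Set.indicator {g : EuclideanSpace ℝ (Fin n) |
      g i ∈ Set.Ioo (-t) t} (fun _ => (1 : ℝ≥0∞)) g = A.card := by
    simp [Set.indicator_apply, hA, Finset.sum_boole]
  rw [hsum, ← ENNReal.ofReal_natCast]
  refine ENNReal.ofReal_le_ofReal ?_
  by_contra! hlt
  have hcompl : (n : ℝ) / 2 ≤ (Aᶜ.card : ℝ) := by
    have : (A.card : ℝ) + Aᶜ.card = n := by
      exact_mod_cast (by simp : A.card + Aᶜ.card = n)
    linarith
  have hnorm : ‖g‖ ^ 2 < c ^ 2 * (n * v) := by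
    have := pow_lt_pow_left₀ hg (norm_nonneg g) two_ne_zero
    rwa [mul_pow, Real.sq_sqrt (by positivity)] at this
  have hlow : (Aᶜ.card : ℝ) * t ^ 2 ≤ ‖g‖ ^ 2 := by
    rw [EuclideanSpace.real_norm_sq_eq, ← nsmul_eq_mul]
    refine (Finset.card_nsmul_le_sum Aᶜ (fun i => g i ^ 2) (t ^ 2) fun i hi => ?_).trans
      (Finset.sum_le_sum_of_subset_of_nonneg (Finset.subset_univ _) fun i _ _ => sq_nonneg _)
    simp only [hA, Set.mem_Ioo, Finset.compl_filter, Finset.mem_filter, Finset.mem_univ,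
      true_and] at hi
    refine sq_le_sq.2 ?_
    rw [abs_of_pos ht]
    by_contra! hcon
    exact hi (abs_lt.1 hcon)
  have : (n : ℝ) / 2 * t ^ 2 ≤ Aᶜ.card * t ^ 2 := by gcongr
  rw [ht2] at this hlow
  nlinarith

end isotropicGaussian

/-! ### Pairs of landmarks that separate two balls -/

section separatingPairs

variable {n : ℕ}

/-- The pairs of landmarks whose bisecting hyperplane separates the ball of radius `δ` around `a`
from the ball of radius `δ` around `b`, with `a` on the side of the first landmark. -/
def separatingPairs (a b : EuclideanSpace ℝ (Fin n)) (δ : ℝ) :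
    Set (EuclideanSpace ℝ (Fin n) × EuclideanSpace ℝ (Fin n)) :=
  {z | 2 * δ * ‖z.2 - z.1‖ < ‖a - z.2‖ ^ 2 - ‖a - z.1‖ ^ 2 ∧
    ‖b - z.2‖ ^ 2 - ‖b - z.1‖ ^ 2 < -(2 * δ * ‖z.2 - z.1‖)}

lemma measurableSet_separatingPairs (a b : EuclideanSpace ℝ (Fin n)) (δ : ℝ) :
    MeasurableSet (separatingPairs a b δ) := by
  simp only [separatingPairs, Set.ofPred_and]
  exact (measurableSet_lt (by fun_prop) (by fun_prop)).inter
    (measurableSet_lt (by fun_prop) (by fun_prop))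

lemma measurableSet_inner_mem_Ioo (a b : EuclideanSpace ℝ (Fin n)) (δ : ℝ) :
    MeasurableSet {z : EuclideanSpace ℝ (Fin n) × EuclideanSpace ℝ (Fin n) |
      inner ℝ z.2 z.1 ∈ Set.Ioo (√2 * (inner ℝ a z.2 + δ * ‖z.2‖))
        (√2 * (inner ℝ b z.2 - δ * ‖z.2‖))} := by
  simp only [Set.mem_Ioo, Set.ofPred_and]
  exact (measurableSet_lt (by fun_prop) (by fun_prop)).inter
    (measurableSet_lt (by fun_prop) (by fun_prop))

/-- The terms `‖x‖²` cancel, so the compared quantity is affine in `x` with gradient `-2 (q - p)`.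
-/
lemma norm_sub_sq_sub_norm_sub_sq (p q x : EuclideanSpace ℝ (Fin n)) :
    ‖x - q‖ ^ 2 - ‖x - p‖ ^ 2 = inner ℝ (q - p) (p + q) - 2 * inner ℝ x (q - p) := by
  rw [norm_sub_sq_real, norm_sub_sq_real, inner_sub_right, inner_sub_left, inner_add_right,
    inner_add_right, real_inner_self_eq_norm_sq, real_inner_self_eq_norm_sq, real_inner_comm p q]
  ring

/-- Cauchy–Schwarz for the affine form. The Lipschitz constant `2‖q - p‖` explains the margin in
`separatingPairs`. -/
lemma abs_norm_sub_sq_sub_norm_sub_sq_sub_le (p q x a : EuclideanSpace ℝ (Fin n)) :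
    |(‖x - q‖ ^ 2 - ‖x - p‖ ^ 2) - (‖a - q‖ ^ 2 - ‖a - p‖ ^ 2)| ≤ 2 * ‖x - a‖ * ‖q - p‖ := by
  rw [norm_sub_sq_sub_norm_sub_sq, norm_sub_sq_sub_norm_sub_sq]
  have h := abs_real_inner_le_norm (x - a) (q - p)
  rw [inner_sub_left] at h
  rw [abs_le] at h ⊢
  constructor <;> linarith [h.1, h.2]

/-- Moving by at most `δ` uses up no more than the margin, and the margin is strict, so both signs
are nonzero and `tie` never enters. -/
lemma comparison_ne_of_mem_separatingPairs (tie : SignType) {a b p q x y : EuclideanSpace ℝ (Fin n)}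
    {δ : ℝ} (h : (p, q) ∈ separatingPairs a b δ) (hx : ‖x - a‖ ≤ δ) (hy : ‖y - b‖ ≤ δ) :
    comparison tie p q x ≠ comparison tie p q y := by
  obtain ⟨h1, h2⟩ := h
  simp only at h1 h2
  have hxa := (abs_le.1 (abs_norm_sub_sq_sub_norm_sub_sq_sub_le p q x a)).1
  have hyb := (abs_le.1 (abs_norm_sub_sq_sub_norm_sub_sq_sub_le p q y b)).2
  have hx' : 2 * ‖x - a‖ * ‖q - p‖ ≤ 2 * δ * ‖q - p‖ := by gcongr
  have hy' : 2 * ‖y - b‖ * ‖q - p‖ ≤ 2 * δ * ‖q - p‖ := by gcongr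
  have hpos : 0 < ‖x - q‖ ^ 2 - ‖x - p‖ ^ 2 := by linarith
  have hneg : ‖y - q‖ ^ 2 - ‖y - p‖ ^ 2 < 0 := by linarith
  simp [comparison, signWithTie, hpos.ne', hneg.ne, sign_pos hpos, sign_neg hneg]

/-- In the rotated coordinates `h = (p + q) / √2`, `g = (q - p) / √2`, the pair `(p, q)` is
separating if `⟪g, h⟫` lies in an interval that depends on `g` only. -/
lemma separatingPairs_eq_preimage_rotation (a b : EuclideanSpace ℝ (Fin n)) (δ : ℝ) :
    separatingPairs a b δ = ContinuousLinearMap.rotation (Real.pi / 4) ⁻¹'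
      {z | inner ℝ z.2 z.1 ∈ Set.Ioo (√2 * (inner ℝ a z.2 + δ * ‖z.2‖))
        (√2 * (inner ℝ b z.2 - δ * ‖z.2‖))} := by
  ext ⟨p, q⟩
  have hs : √2 * √2 = (2 : ℝ) := Real.mul_self_sqrt (by norm_num)
  have hs0 : (0 : ℝ) < √2 := by positivity
  have hrot : ContinuousLinearMap.rotation (Real.pi / 4) (p, q) =
      ((√2 / 2) • (p + q), (√2 / 2) • (q - p)) := by
    rw [ContinuousLinearMap.rotation_apply, Real.cos_pi_div_four, Real.sin_pi_div_four]
    ext1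
    · simp [smul_add]
    · simp [sub_eq_neg_add]
  simp only [separatingPairs, norm_sub_sq_sub_norm_sub_sq, Set.mem_preimage, hrot,
    Set.mem_ofPred_eq, Set.mem_Ioo, inner_smul_left, inner_smul_right, norm_smul,
    Real.norm_of_nonneg (show (0 : ℝ) ≤ √2 / 2 by positivity)]
  simp only [RCLike.conj_to_real]
  have e1 : √2 / 2 * (√2 / 2 * inner ℝ (q - p) (p + q)) = inner ℝ (q - p) (p + q) / 2 := by
    linear_combination (inner ℝ (q - p) (p + q) / 4) * hs
  have e2 (c : EuclideanSpace ℝ (Fin n)) (d : ℝ) :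
      √2 * (√2 / 2 * inner ℝ c (q - p) + d * (√2 / 2 * ‖q - p‖)) =
        inner ℝ c (q - p) + d * ‖q - p‖ := by
    linear_combination ((inner ℝ c (q - p) + d * ‖q - p‖) / 2) * hs
  have e3 : √2 * (√2 / 2 * inner ℝ b (q - p) - δ * (√2 / 2 * ‖q - p‖)) =
        inner ℝ b (q - p) - δ * ‖q - p‖ := by
    linear_combination ((inner ℝ b (q - p) - δ * ‖q - p‖) / 2) * hs
  rw [e1, e2, e3]
  constructor <;> rintro ⟨h1, h2⟩ <;> constructor <;> linarith

/-- The product of two copies of a centred Gaussian law is rotation invariant, so `h` and `g` are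
again independent and `g` can be frozen. -/
lemma isotropicGaussian_prod_separatingPairs (a b : EuclideanSpace ℝ (Fin n)) (δ v : ℝ) :
    ((isotropicGaussian n v).prod (isotropicGaussian n v)).real (separatingPairs a b δ) =
      ((isotropicGaussian n v).prod (isotropicGaussian n v)).real
        {z | inner ℝ z.2 z.1 ∈ Set.Ioo (√2 * (inner ℝ a z.2 + δ * ‖z.2‖))
          (√2 * (inner ℝ b z.2 - δ * ‖z.2‖))} := by
  conv_rhs => rw [← IsGaussian.map_rotation_eq_self integral_id_isotropicGaussian (Real.pi / 4)]
  rw [map_measureReal_apply (by fun_prop) (measurableSet_inner_mem_Ioo a b δ),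
    separatingPairs_eq_preimage_rotation]

/-- A lower bound for a product measure by fibres over a measurable set. -/
lemma mul_measureReal_le_prod_real {α β : Type*} [MeasurableSpace α] [MeasurableSpace β]
    {μ : Measure α} {ν : Measure β} [IsFiniteMeasure μ] [IsFiniteMeasure ν]
    {T : Set (α × β)} (hT : MeasurableSet T) {G : Set β} (hG : MeasurableSet G) {c : ℝ}
    (hc : 0 ≤ c) (h : ∀ g ∈ G, c ≤ μ.real {x | (x, g) ∈ T}) :
    c * ν.real G ≤ (μ.prod ν).real T := by
  have h1 : ENNReal.ofReal c * ν G ≤ (μ.prod ν) T := by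
    rw [Measure.prod_apply_symm hT, ← setLIntegral_const]
    refine (setLIntegral_mono' hG fun g hg => ?_).trans (setLIntegral_le_lintegral _ _)
    exact (ENNReal.ofReal_le_iff_le_toReal (measure_ne_top _ _)).2 (h g hg)
  have h2 := ENNReal.toReal_mono (measure_ne_top _ _) h1
  rwa [ENNReal.toReal_mul, ENNReal.toReal_ofReal hc] at h2

/-- For a fixed typical difference `g` of the landmarks, the hyperplane separates two balls with
probability at least a constant times `ε / R`. -/
lemma isotropicGaussian_inner_mem_Ioo_ge {R ε K c : ℝ} (hn : 1 ≤ n) (hR : 0 < R) (hε : 0 < ε)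
    (hK : 0 < K) (hc : 0 < c) {a b g : EuclideanSpace ℝ (Fin n)} (hab : ε / 2 ≤ ‖b - a‖)
    (hg : √(2 * R ^ 2 / n) * ‖b - a‖ < inner ℝ (b - a) g)
    (ha : |inner ℝ a g| < K * (R * √(2 * R ^ 2 / n)))
    (hb : |inner ℝ b g| < K * (R * √(2 * R ^ 2 / n)))
    (hgK : ‖g‖ < K * (√2 * R)) (hgc : c * (√2 * R) ≤ ‖g‖) :
    Real.exp (-(K ^ 2 / (2 * c ^ 2))) / (4 * K * √(2 * Real.pi)) * (ε / R) ≤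
      (isotropicGaussian n (2 * R ^ 2 / n)).real
        {h | inner ℝ g h ∈ Set.Ioo (√2 * (inner ℝ a g + ε / (8 * K * √n) * ‖g‖))
          (√2 * (inner ℝ b g - ε / (8 * K * √n) * ‖g‖))} := by
  have hn0 : (0 : ℝ) < n := by exact_mod_cast hn
  set v := 2 * R ^ 2 / n with hv_def
  have hv : 0 < v := by positivity
  set s := √v with hs_def
  have hs : 0 < s := Real.sqrt_pos.2 hv
  have hss : s ^ 2 = v := Real.sq_sqrt hv.le
  have hs' : s = √2 * R / √n := by
    rw [hs_def, hv_def, Real.sqrt_div (by positivity), Real.sqrt_mul (by norm_num),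
      Real.sqrt_sq hR.le]
  have h2 : √2 ^ 2 = (2 : ℝ) := Real.sq_sqrt (by norm_num)
  have h20 : (0 : ℝ) < √2 := by positivity
  have hg0 : 0 < ‖g‖ := lt_of_lt_of_le (by positivity) hgc
  have hδ : ε / (8 * K * √n) * ‖g‖ ≤ s * ε / 8 := by
    calc ε / (8 * K * √n) * ‖g‖ ≤ ε / (8 * K * √n) * (K * (√2 * R)) := by gcongr
      _ = s * ε / 8 := by rw [hs']; field_simp
  have hδ0 : 0 ≤ ε / (8 * K * √n) * ‖g‖ := by positivity
  -- The gap `⟪b - a, g⟫` is at least `s ε / 2`, and each of the two margins costs at most `s ε /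
  -- 8`.
  have hlen : s * ε / 4 ≤ (inner ℝ b g - ε / (8 * K * √n) * ‖g‖) -
      (inner ℝ a g + ε / (8 * K * √n) * ‖g‖) := by
    have h1 : s * (ε / 2) ≤ s * ‖b - a‖ := by gcongr
    rw [inner_sub_left] at hg
    linarith
  have hsε : 0 < s * ε := by positivity
  have hw : (v * ‖g‖ ^ 2).toNNReal ≠ 0 := by
    simp only [ne_eq, Real.toNNReal_eq_zero, not_le]; positivity
  have hmain := gaussianReal_Ioo_ge hw
    (l := √2 * (inner ℝ a g + ε / (8 * K * √n) * ‖g‖))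
    (u := √2 * (inner ℝ b g - ε / (8 * K * √n) * ‖g‖)) (M := √2 * (K * (R * s)))
    (mul_le_mul_of_nonneg_left (by linarith) h20.le)
    (by rw [← mul_neg]; exact mul_le_mul_of_nonneg_left (by linarith [(abs_lt.1 ha).1]) h20.le)
    (mul_le_mul_of_nonneg_left (by linarith [(abs_lt.1 hb).2]) h20.le)
  rw [isotropicGaussian_real_preimage_inner hv.le g measurableSet_Ioo]
  refine le_trans ?_ hmain
  rw [Real.coe_toNNReal _ (by positivity), Real.sqrt_mul (by positivity) (v * ‖g‖ ^ 2),
    Real.sqrt_mul hv.le, Real.sqrt_sq hg0.le, ← hs_def, ← mul_sub]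
  -- The lower bound on `‖g‖` keeps the interval within boundedly many deviations of `0`; the upper
  -- bound on `‖g‖` serves the prefactor of the density.
  have hexp : Real.exp (-(K ^ 2 / (2 * c ^ 2))) ≤
      Real.exp (-(√2 * (K * (R * s))) ^ 2 / (2 * (v * ‖g‖ ^ 2))) := by
    rw [neg_div]
    refine Real.exp_le_exp.2 (neg_le_neg ?_)
    calc (√2 * (K * (R * s))) ^ 2 / (2 * (v * ‖g‖ ^ 2))
        ≤ (√2 * (K * (R * s))) ^ 2 / (2 * (v * (c * (√2 * R)) ^ 2)) := by gcongr
      _ = K ^ 2 / (2 * c ^ 2) := by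
          rw [mul_pow, mul_pow, mul_pow, mul_pow, mul_pow, h2, hss]
          field_simp
  calc Real.exp (-(K ^ 2 / (2 * c ^ 2))) / (4 * K * √(2 * Real.pi)) * (ε / R)
      = √2 * (s * ε / 4) * ((√(2 * Real.pi) * (s * (K * (√2 * R))))⁻¹ *
          Real.exp (-(K ^ 2 / (2 * c ^ 2)))) := by field_simp
    _ ≤ _ := by
      have hlen0 := (by positivity : 0 ≤ s * ε / 4).trans hlen
      gcongr

/-- A random pair of landmarks separates two balls of radius of order `ε / √n`, whose centres are
at distance at least `ε / 2`, with probability at least a constant times `ε / R`. -/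
lemma exists_isotropicGaussian_prod_separatingPairs_ge :
    ∃ c₀ K : ℝ, 0 < c₀ ∧ 4 ≤ K ∧ ∀ (n : ℕ) (R ε : ℝ), 1 ≤ n → 0 < R → 0 < ε →
      ∀ a ∈ Metric.closedBall (0 : EuclideanSpace ℝ (Fin n)) R,
        ∀ b ∈ Metric.closedBall (0 : EuclideanSpace ℝ (Fin n)) R, ε / 2 ≤ ‖a - b‖ →
          c₀ * (ε / R) ≤ ((isotropicGaussian n (2 * R ^ 2 / n)).prod
            (isotropicGaussian n (2 * R ^ 2 / n))).real
              (separatingPairs a b (ε / (K * √n))) := by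
  set c₁ : ℝ := (√(2 * Real.pi))⁻¹ * Real.exp (-2) with hc₁_def
  have hc₁ : 0 < c₁ := by positivity
  have hc₁' : c₁ ≤ 1 := by
    refine mul_le_one₀ (inv_le_one_of_one_le₀ (Real.one_le_sqrt.2 ?_)) (Real.exp_pos _).le
      (Real.exp_le_one_iff.2 (by norm_num))
    linarith [Real.pi_gt_three]
  -- `K` and `c` make each of the four exceptional events for `g` have probability at most `c₁ / 8`,
  -- which leaves `c₁ / 2` of the favourable mass `c₁`.
  set K := 8 / c₁ with hK_def
  have hK : 8 ≤ K := by rw [hK_def, le_div_iff₀ hc₁]; linarith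
  have hK0 : 0 < K := by linarith
  set c := c₁ / 32 with hc_def
  have hc : 0 < c := by positivity
  have hK2 : 1 / K ^ 2 ≤ c₁ / 8 := by
    rw [hK_def, div_pow, one_div_div, div_le_div_iff₀ (by norm_num) (by norm_num)]
    nlinarith
  set d := Real.exp (-(K ^ 2 / (2 * c ^ 2))) / (4 * K * √(2 * Real.pi)) with hd_def
  have hd : 0 < d := by positivity
  refine ⟨d * (c₁ / 2), 8 * K, by positivity, by linarith, ?_⟩
  intro n R ε hn hR hε a ha b hb hab
  have hn0 : (0 : ℝ) < n := by exact_mod_cast hn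
  rw [mem_closedBall_zero_iff] at ha hb
  rw [norm_sub_rev] at hab
  have hba : b - a ≠ 0 := norm_pos_iff.1 (by linarith)
  set v := 2 * R ^ 2 / n with hv_def
  have hv : 0 < v := by positivity
  have hnv : √(n * v) = √2 * R := by
    rw [hv_def, mul_div_cancel₀ _ hn0.ne', Real.sqrt_mul (by norm_num), Real.sqrt_sq hR.le]
  have hs : 0 < √v := Real.sqrt_pos.2 hv
  set μ := isotropicGaussian n v with hμ
  have htail (z : EuclideanSpace ℝ (Fin n)) (hz : ‖z‖ ≤ R) :
      μ.real {g | K * (R * √v) ≤ |inner ℝ z g|} ≤ c₁ / 8 := by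
    refine (isotropicGaussian_abs_inner_ge_le hv.le z (by positivity)).trans (le_trans ?_ hK2)
    rw [mul_pow, mul_pow, Real.sq_sqrt hv.le]
    calc v * ‖z‖ ^ 2 / (K ^ 2 * (R ^ 2 * v)) ≤ v * R ^ 2 / (K ^ 2 * (R ^ 2 * v)) := by gcongr
      _ = 1 / K ^ 2 := by field_simp
  have hlarge : μ.real {g | K * (√2 * R) ≤ ‖g‖} ≤ c₁ / 8 := by
    refine (isotropicGaussian_norm_ge_le hv.le (by positivity)).trans (le_trans (le_of_eq ?_) hK2)
    rw [← hnv, mul_pow, Real.sq_sqrt (by positivity)]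
    field_simp
  have hsmall : μ.real {g | ‖g‖ < c * (√2 * R)} ≤ c₁ / 8 := by
    rw [← hnv]
    exact (isotropicGaussian_norm_lt_le hn hv hc).trans_eq (by rw [hc_def]; ring)
  set G := {g : EuclideanSpace ℝ (Fin n) | √v * ‖b - a‖ < inner ℝ (b - a) g ∧
    |inner ℝ a g| < K * (R * √v) ∧ |inner ℝ b g| < K * (R * √v) ∧
    ‖g‖ < K * (√2 * R) ∧ c * (√2 * R) ≤ ‖g‖} with hG_def
  have hG : MeasurableSet G := by
    simp only [hG_def, Set.ofPred_and]
    exact (measurableSet_lt (by fun_prop) (by fun_prop)).inter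
      ((measurableSet_lt (Measurable.abs (by fun_prop)) (by fun_prop)).inter
      ((measurableSet_lt (Measurable.abs (by fun_prop)) (by fun_prop)).inter
      ((measurableSet_lt (by fun_prop) (by fun_prop)).inter
      (measurableSet_le (by fun_prop) (by fun_prop)))))
  have hGge : c₁ / 2 ≤ μ.real G := by
    have hsub : {g : EuclideanSpace ℝ (Fin n) | √v * ‖b - a‖ < inner ℝ (b - a) g} ⊆
        G ∪ ({g | K * (R * √v) ≤ |inner ℝ a g|} ∪ ({g | K * (R * √v) ≤ |inner ℝ b g|} ∪
          ({g | K * (√2 * R) ≤ ‖g‖} ∪ {g | ‖g‖ < c * (√2 * R)}))) := by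
      intro g hg
      refine or_iff_not_imp_right.2 fun h => ?_
      simp only [Set.mem_union, Set.mem_ofPred_eq, not_or, not_le, not_lt] at h
      exact ⟨hg, h.1, h.2.1, h.2.2.1, h.2.2.2⟩
    have h0 := isotropicGaussian_inner_gt_ge hv hba
    have h1 := h0.trans (measureReal_mono hsub (measure_ne_top _ _))
    have h2 := htail a ha
    have h3 := htail b hb
    have u1 := h1.trans (measureReal_union_le _ _)
    have u2 := measureReal_union_le (μ := μ) {g | K * (R * √v) ≤ |inner ℝ a g|}
      ({g | K * (R * √v) ≤ |inner ℝ b g|} ∪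
          ({g | K * (√2 * R) ≤ ‖g‖} ∪ {g | ‖g‖ < c * (√2 * R)}))
    have u3 := measureReal_union_le (μ := μ) {g | K * (R * √v) ≤ |inner ℝ b g|}
          ({g | K * (√2 * R) ≤ ‖g‖} ∪ {g | ‖g‖ < c * (√2 * R)})
    have u4 := measureReal_union_le (μ := μ) {g | K * (√2 * R) ≤ ‖g‖} {g | ‖g‖ < c * (√2 * R)}
    linarith
  rw [isotropicGaussian_prod_separatingPairs]
  refine le_trans ?_ (mul_measureReal_le_prod_real (c := d * (ε / R))
    (measurableSet_inner_mem_Ioo _ _ _) hG (by positivity) fun g hg => ?_)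
  · calc d * (c₁ / 2) * (ε / R) = d * (ε / R) * (c₁ / 2) := by ring
      _ ≤ d * (ε / R) * μ.real G := by gcongr
  · exact isotropicGaussian_inner_mem_Ioo_ge hn hR hε hK0 hc hab hg.1 hg.2.1 hg.2.2.1
      hg.2.2.2.1 hg.2.2.2.2

end separatingPairs

/-! ### Covering a Euclidean ball -/

/-- A finite `δ`-net of the Euclidean ball of radius `R`, obtained from a cubic grid. -/
lemma exists_finset_cover_closedBall {n : ℕ} (hn : 1 ≤ n) {R δ : ℝ} (hR : 0 < R) (hδ : 0 < δ) :
    ∃ N : Finset (EuclideanSpace ℝ (Fin n)),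
      (∀ a ∈ N, a ∈ Metric.closedBall (0 : EuclideanSpace ℝ (Fin n)) R) ∧
      (N.card : ℝ) ≤ (2 * R * √n / δ + 2) ^ n ∧
      ∀ x ∈ Metric.closedBall (0 : EuclideanSpace ℝ (Fin n)) R, ∃ a ∈ N, ‖x - a‖ ≤ δ := by
  classical
  have hn0 : (0 : ℝ) < n := by exact_mod_cast hn
  -- Two points in a common cube of side `δ / √n` are at distance at most `δ`.
  set h := δ / √n with hh_def
  have hh : 0 < h := by positivity
  let cell : EuclideanSpace ℝ (Fin n) → Fin n → ℤ := fun x i => ⌊x i / h⌋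
  let T : Finset (Fin n → ℤ) := Fintype.piFinset fun _ => Finset.Icc ⌊-R / h⌋ ⌊R / h⌋
  have hcell : ∀ x ∈ Metric.closedBall (0 : EuclideanSpace ℝ (Fin n)) R, cell x ∈ T := by
    intro x hx
    rw [mem_closedBall_zero_iff] at hx
    refine Fintype.mem_piFinset.2 fun i => Finset.mem_Icc.2 ?_
    have hxi : |x i| ≤ R := (PiLp.norm_apply_le x i).trans hx
    rw [abs_le] at hxi
    exact ⟨Int.floor_le_floor (by gcongr; exact hxi.1), Int.floor_le_floor (by gcongr; exact hxi.2)⟩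
  -- Each cell that meets the ball is represented by a point of the ball, since the net must stay
  -- inside; the other cells get the dummy value `0`.
  have hrep : ∀ t : Fin n → ℤ, ∃ a ∈ Metric.closedBall (0 : EuclideanSpace ℝ (Fin n)) R,
      (∃ x ∈ Metric.closedBall (0 : EuclideanSpace ℝ (Fin n)) R, cell x = t) → cell a = t := by
    intro t
    by_cases ht : ∃ x ∈ Metric.closedBall (0 : EuclideanSpace ℝ (Fin n)) R, cell x = t
    · obtain ⟨x, hx, hxt⟩ := ht
      exact ⟨x, hx, fun _ => hxt⟩
    · exact ⟨0, Metric.mem_closedBall_self hR.le, fun h => absurd h ht⟩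
  choose rep hrep_mem hrep_cell using hrep
  refine ⟨T.image rep, ?_, ?_, ?_⟩
  · intro a ha
    obtain ⟨t, -, rfl⟩ := Finset.mem_image.1 ha
    exact hrep_mem t
  · have hT : T.card = (⌊R / h⌋ + 1 - ⌊-R / h⌋).toNat ^ n := by
      simp [T]
    have hside : ((⌊R / h⌋ + 1 - ⌊-R / h⌋).toNat : ℝ) ≤ 2 * R * √n / δ + 2 := by
      have hle : ⌊-R / h⌋ ≤ ⌊R / h⌋ :=
        Int.floor_le_floor (by gcongr; linarith)
      have hcast : ((⌊R / h⌋ + 1 - ⌊-R / h⌋).toNat : ℝ) =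
          ((⌊R / h⌋ + 1 - ⌊-R / h⌋ : ℤ) : ℝ) := by
        exact_mod_cast Int.toNat_of_nonneg (by linarith)
      rw [hcast]
      push_cast
      have h1 := Int.floor_le (R / h)
      have h2 := Int.lt_floor_add_one (-R / h)
      have h3 : 2 * R * √n / δ = R / h - -R / h := by rw [hh_def]; field_simp; ring
      linarith
    calc ((T.image rep).card : ℝ) ≤ T.card := by exact_mod_cast Finset.card_image_le
      _ ≤ _ := by
        rw [hT, Nat.cast_pow]
        gcongr
  · intro x hx
    refine ⟨rep (cell x), Finset.mem_image_of_mem _ (hcell x hx), ?_⟩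
    have heq : cell (rep (cell x)) = cell x := hrep_cell _ ⟨x, hx, rfl⟩
    set a := rep (cell x)
    have hcoord (i : Fin n) : (x i - a i) ^ 2 ≤ h ^ 2 := by
      have h1 : |x i / h - a i / h| < 1 :=
        Int.abs_sub_lt_one_of_floor_eq_floor (congrFun heq i).symm
      rw [← sub_div, abs_div, abs_of_pos hh, div_lt_one hh] at h1
      rw [← sq_abs]
      gcongr
    have hsq : ‖x - a‖ ^ 2 ≤ δ ^ 2 := by
      rw [EuclideanSpace.real_norm_sq_eq]
      calc ∑ i, ((x - a) i) ^ 2 ≤ ∑ _i : Fin n, h ^ 2 := Finset.sum_le_sum fun i _ => hcoord i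
        _ = δ ^ 2 := by
          rw [Finset.sum_const, Finset.card_univ, Fintype.card_fin, nsmul_eq_mul, hh_def, div_pow,
            Real.sq_sqrt hn0.le]
          field_simp
    exact le_of_sq_le_sq hsq hδ.le

/-! ### Independent pairs -/

/-- If the variables `p i`, `q i` are jointly independent with law `μ`, then the pairs
`(p i, q i)` are independent with law `μ.prod μ`. -/
lemma map_pairs_eq_pi_prod {Ω E : Type*} [MeasurableSpace Ω] [MeasurableSpace E] {P : Measure Ω}
    {μ : Measure E} [IsProbabilityMeasure μ] {m : ℕ} {p q : Fin m → Ω → E}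
    (hp : ∀ i, HasLaw (p i) μ P) (hq : ∀ i, HasLaw (q i) μ P) (h : iIndepFun (Sum.elim p q) P) :
    P.map (fun ω i => (p i ω, q i ω)) = Measure.pi fun _ => μ.prod μ := by
  have hlaw : ∀ j, HasLaw (Sum.elim p q j) μ P := by
    rintro (i | i)
    · exact hp i
    · exact hq i
  have hae : AEMeasurable (fun ω j => Sum.elim p q j ω) P :=
    aemeasurable_pi_iff.2 fun j => (hlaw j).aemeasurable
  have hmap : P.map (fun ω j => Sum.elim p q j ω) = Measure.pi fun _ => μ := by
    rw [h.map_fun_eq_pi_map fun j => (hlaw j).aemeasurable]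
    congr 1
    funext j
    exact (hlaw j).map_eq
  -- Regrouping the coordinates indexed by `Fin m ⊕ Fin m` into `m` pairs preserves the product
  -- measure.
  have h1 := measurePreserving_sumPiEquivProdPi (fun _ : Fin m ⊕ Fin m => μ)
  have h2 := (measurePreserving_arrowProdEquivProdArrow E E (Fin m) (fun _ => μ)
    (fun _ => μ)).symm
  have h3 := (h2.comp h1).map_eq
  rw [← hmap, AEMeasurable.map_map_of_aemeasurable (h2.comp h1).measurable.aemeasurable hae] at h3
  exact h3

/-- The probability that no pair `(p i, q i)` lies in `S`. -/
lemma measureReal_forall_pair_notMem {Ω E : Type*} [MeasurableSpace Ω] [MeasurableSpace E]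
    {P : Measure Ω} {μ : Measure E} [IsProbabilityMeasure μ] {m : ℕ} {p q : Fin m → Ω → E}
    (hp : ∀ i, HasLaw (p i) μ P) (hq : ∀ i, HasLaw (q i) μ P) (h : iIndepFun (Sum.elim p q) P)
    {S : Set (E × E)} (hS : MeasurableSet S) :
    P.real {ω | ∀ i, (p i ω, q i ω) ∉ S} = (1 - (μ.prod μ).real S) ^ m := by
  have hae : AEMeasurable (fun ω i => (p i ω, q i ω)) P :=
    aemeasurable_pi_iff.2 fun i => (hp i).aemeasurable.prodMk (hq i).aemeasurable
  have hset : {ω | ∀ i, (p i ω, q i ω) ∉ S} =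
      (fun ω i => (p i ω, q i ω)) ⁻¹' Set.univ.pi fun _ : Fin m => Sᶜ := by
    ext ω; simp
  have hmeas : MeasurableSet (Set.univ.pi fun _ : Fin m => Sᶜ) :=
    MeasurableSet.univ_pi fun _ => hS.compl
  rw [hset, measureReal_def, ← Measure.map_apply_of_aemeasurable hae hmeas,
    map_pairs_eq_pi_prod hp hq h, Measure.pi_pi, Finset.prod_const, Finset.card_univ,
    Fintype.card_fin, ENNReal.toReal_pow, ← measureReal_def, probReal_compl_eq_one_sub hS]

/-! ### The union bound -/

/-- If the number of landmark pairs is large compared with the entropy of a net and `log (1 / η)`,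
the union bound over the pairs of points of the net is at most `η`. -/
lemma card_sq_mul_one_sub_pow_le {κ K c₀ : ℝ} (hκ : 1 < κ) (hK : 0 < K) (hc₀ : 0 < c₀)
    {n m : ℕ} {R ε η N θ : ℝ} (hn : 1 ≤ n) (hR : 0 < R) (hε : 0 < ε) (hη : 0 < η) (hη1 : η < 1)
    (hεR : ε < 2 * R) (hr : κ ≤ R * √n / ε) (hN0 : 0 ≤ N)
    (hN : N ≤ (2 * R * √n / (ε / (K * √n)) + 2) ^ n) (hθ : c₀ * (ε / R) ≤ θ) (hθ1 : θ ≤ 1)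
    (hm : (2 * (2 + Real.log (4 * K + 2) / Real.log κ) + 1) / c₀ * (R / ε) *
      (n * Real.log (R * √n / ε) + Real.log (1 / η)) ≤ m) :
    N ^ 2 * (1 - θ) ^ m ≤ η := by
  have hn0 : (0 : ℝ) < n := by exact_mod_cast hn
  set r := R * √n / ε with hr_def
  have hr0 : 0 < r := by positivity
  have hr1 : 1 < r := hκ.trans_le hr
  set L := Real.log r with hL_def
  have hlogκ : 0 < Real.log κ := Real.log_pos hκ
  have hκL : Real.log κ ≤ L := Real.log_le_log (by linarith) hr
  have hL : 0 < L := hlogκ.trans_le hκL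
  have hlogK : 0 < Real.log (4 * K + 2) := Real.log_pos (by linarith)
  -- Chosen so that `(4K + 2) r² ≤ r ^ A` whenever `r ≥ κ`; this is the source of the dependence on
  -- `κ`.
  set A := 2 + Real.log (4 * K + 2) / Real.log κ with hA_def
  have hA : 0 < A := by positivity
  have hη' : 0 < Real.log (1 / η) := Real.log_pos (by rw [lt_div_iff₀ hη]; linarith)
  -- Since `ε < 2R`, the extra factor `√n` in the size of the net costs only another power of `r`.
  have hsqrt : √n ≤ 2 * r := by
    rw [hr_def, mul_div_assoc', le_div_iff₀ hε]
    nlinarith [Real.sqrt_pos.2 hn0]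
  have hbase : 2 * R * √n / (ε / (K * √n)) + 2 ≤ (4 * K + 2) * r ^ 2 := by
    have h1 : 2 * R * √n / (ε / (K * √n)) = 2 * K * r * √n := by rw [hr_def]; field_simp
    have h2 : 2 * K * r * √n ≤ 2 * K * r * (2 * r) := by gcongr
    rw [h1]
    nlinarith
  have hexpbase : (4 * K + 2) * r ^ 2 ≤ Real.exp (A * L) := by
    rw [← Real.exp_log (show 0 < (4 * K + 2) * r ^ 2 by positivity),
      Real.log_mul (by positivity) (by positivity), Real.log_pow]
    refine Real.exp_le_exp.2 ?_
    have h1 : Real.log (4 * K + 2) ≤ Real.log (4 * K + 2) / Real.log κ * L := by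
      rw [div_mul_eq_mul_div, le_div_iff₀ hlogκ]
      gcongr
    rw [hA_def, add_mul]
    push_cast
    linarith
  have hNexp : N ≤ Real.exp (n * (A * L)) := by
    rw [Real.exp_nat_mul]
    exact hN.trans (pow_le_pow_left₀ (by positivity) (hbase.trans hexpbase) n)
  have hpow : (1 - θ) ^ m ≤ Real.exp (m * -(c₀ * (ε / R))) := by
    rw [Real.exp_nat_mul]
    refine pow_le_pow_left₀ (by linarith) ?_ m
    exact (Real.one_sub_le_exp_neg θ).trans (Real.exp_le_exp.2 (by linarith))
  have hm' : (2 * A + 1) * (n * L + Real.log (1 / η)) ≤ m * (c₀ * (ε / R)) := by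
    have h1 := mul_le_mul_of_nonneg_right hm (show 0 ≤ c₀ * (ε / R) by positivity)
    refine le_trans (le_of_eq ?_) h1
    field_simp
  calc N ^ 2 * (1 - θ) ^ m
      ≤ Real.exp (n * (A * L)) ^ 2 * Real.exp (m * -(c₀ * (ε / R))) := by
        have : 0 ≤ (1 - θ) ^ m := pow_nonneg (by linarith) m
        gcongr
    _ = Real.exp (2 * (n * (A * L)) - m * (c₀ * (ε / R))) := by
        rw [← Real.exp_nat_mul, ← Real.exp_add]
        push_cast
        ring_nf
    -- Of the factor `2A + 1` in `hm'`, the part `2A` pays for the squared net and the remaining `1`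
    -- for `log (1 / η)`.
    _ ≤ Real.exp (-Real.log (1 / η)) := by
        refine Real.exp_le_exp.2 ?_
        have h1 : 0 < n * L := by positivity
        have h2 : 0 < A * Real.log (1 / η) := by positivity
        nlinarith
    _ = η := by rw [one_div, Real.log_inv, neg_neg, Real.exp_log hη]

/-- If every pair of points of an `ε / 4`-net at distance at least `ε / 2` is separated robustly,
then points with equal comparisons are `ε`-close. -/
lemma norm_sub_le_of_comparisons_eq {n m : ℕ} {B : Set (EuclideanSpace ℝ (Fin n))} {δ ε : ℝ}
    (hδ : δ ≤ ε / 4) {N : Set (EuclideanSpace ℝ (Fin n))} (hN : ∀ x ∈ B, ∃ a ∈ N, ‖x - a‖ ≤ δ)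
    {p q : Fin m → EuclideanSpace ℝ (Fin n)}
    (hsep : ∀ a ∈ N, ∀ b ∈ N, ε / 2 ≤ ‖a - b‖ → ∃ i, (p i, q i) ∈ separatingPairs a b δ)
    (tie : SignType) {x y : EuclideanSpace ℝ (Fin n)} (hx : x ∈ B) (hy : y ∈ B)
    (hxy : comparisons tie p q x = comparisons tie p q y) : ‖x - y‖ ≤ ε := by
  by_contra! hlt
  obtain ⟨a, ha, hxa⟩ := hN x hx
  obtain ⟨b, hb, hyb⟩ := hN y hy
  have htri : ‖x - y‖ ≤ ‖x - a‖ + ‖a - b‖ + ‖y - b‖ := by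
    have h1 : x - y = (x - a) + (a - b) - (y - b) := by abel
    rw [h1]
    exact (norm_sub_le _ _).trans (by gcongr; exact norm_add_le _ _)
  -- Here `‖a - b‖ > ε - 2δ ≥ ε / 2`.
  obtain ⟨i, hi⟩ := hsep a ha b hb (by linarith)
  exact comparison_ne_of_mem_separatingPairs tie hi hxa hyb (congrFun hxy i)

theorem theorem1 (κ : ℝ) (hκ : 1 < κ) :
    ∃ C : ℝ, 0 < C ∧
      ∀ (n m : ℕ) (R ε η : ℝ), 1 ≤ n → 0 < R → 0 < ε → 0 < η →
        κ ≤ R * Real.sqrt n / ε →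
        C * (R / ε) * (n * Real.log (R * Real.sqrt n / ε) + Real.log (1 / η)) ≤ m →
        ∀ (tie : SignType) (Ω : Type*) [MeasurableSpace Ω] (P : Measure Ω)
          [IsProbabilityMeasure P] (p q : Fin m → Ω → EuclideanSpace ℝ (Fin n)),
          (∀ i, HasLaw (p i) (isotropicGaussian n (2 * R ^ 2 / n)) P) →
          (∀ i, HasLaw (q i) (isotropicGaussian n (2 * R ^ 2 / n)) P) →
          iIndepFun (Sum.elim p q) P →
          ∃ E : Set Ω, MeasurableSet E ∧ ENNReal.ofReal (1 - η) ≤ P E ∧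
            ∀ ω ∈ E, ∀ x ∈ Metric.closedBall (0 : EuclideanSpace ℝ (Fin n)) R,
              ∀ y ∈ Metric.closedBall (0 : EuclideanSpace ℝ (Fin n)) R,
                comparisons tie (fun i => p i ω) (fun i => q i ω) x =
                  comparisons tie (fun i => p i ω) (fun i => q i ω) y →
                ‖x - y‖ ≤ ε := by
  obtain ⟨c₀, K, hc₀, hK, hprob⟩ := exists_isotropicGaussian_prod_separatingPairs_ge
  have hK0 : 0 < K := by linarith
  have hlogκ : 0 < Real.log κ := Real.log_pos hκ
  have hlogK : 0 < Real.log (4 * K + 2) := Real.log_pos (by linarith)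
  refine ⟨(2 * (2 + Real.log (4 * K + 2) / Real.log κ) + 1) / c₀, by positivity, ?_⟩
  intro n m R ε η hn hR hε hη hr hm tie Ω _ P _ p q hp hq hind
  -- For `η ≥ 1` the empty event suffices, and for `ε ≥ 2R` the diameter of the ball does. The union
  -- bound needs `η < 1` and `ε < 2R`.
  rcases le_or_gt 1 η with hη1 | hη1
  · exact ⟨∅, MeasurableSet.empty, by simpa using hη1, by simp⟩
  rcases le_or_gt (2 * R) ε with hεR | hεR
  · refine ⟨Set.univ, MeasurableSet.univ, by simpa using hη.le, ?_⟩
    intro ω _ x hx y hy _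
    rw [mem_closedBall_zero_iff] at hx hy
    linarith [norm_sub_le x y]
  have hsqrt : 1 ≤ √(n : ℝ) := Real.one_le_sqrt.2 (by exact_mod_cast hn)
  set δ := ε / (K * √n) with hδ_def
  have hδ0 : 0 < δ := by positivity
  have hδ : δ ≤ ε / 4 := by
    rw [hδ_def]
    gcongr
    nlinarith
  obtain ⟨N, hNball, hNcard, hNcover⟩ := exists_finset_cover_closedBall hn hR hδ0
  set μ := isotropicGaussian n (2 * R ^ 2 / n)
  classical
  let D := (N ×ˢ N).filter fun z => ε / 2 ≤ ‖z.1 - z.2‖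
  let F : Set Ω := ⋃ z ∈ D, {ω | ∀ i, (p i ω, q i ω) ∉ separatingPairs z.1 z.2 δ}
  have hF : P.real F ≤ η := by
    -- A pair in `D` is needed to know `c₀ ε / R ≤ 1`, as this number is then a lower bound for a
    -- probability.
    rcases D.eq_empty_or_nonempty with hD | ⟨z₀, hz₀⟩
    · simpa [F, hD] using hη.le
    have hge : ∀ z ∈ D, c₀ * (ε / R) ≤ (μ.prod μ).real (separatingPairs z.1 z.2 δ) := by
      intro z hz
      simp only [D, Finset.mem_filter, Finset.mem_product] at hz
      exact hprob n R ε hn hR hε z.1 (hNball _ hz.1.1) z.2 (hNball _ hz.1.2) hz.2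
    have hle1 : c₀ * (ε / R) ≤ 1 := (hge z₀ hz₀).trans measureReal_le_one
    have hone : ∀ z ∈ D, P.real {ω | ∀ i, (p i ω, q i ω) ∉ separatingPairs z.1 z.2 δ} ≤
        (1 - c₀ * (ε / R)) ^ m := by
      intro z hz
      rw [measureReal_forall_pair_notMem hp hq hind (measurableSet_separatingPairs _ _ _)]
      exact pow_le_pow_left₀ (sub_nonneg.2 measureReal_le_one) (by linarith [hge z hz]) m
    have hcard : (D.card : ℝ) ≤ (N.card : ℝ) ^ 2 := by
      rw [sq, ← Nat.cast_mul, ← Finset.card_product]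
      exact_mod_cast Finset.card_filter_le _ _
    calc P.real F ≤ ∑ z ∈ D, P.real {ω | ∀ i, (p i ω, q i ω) ∉ separatingPairs z.1 z.2 δ} :=
          measureReal_biUnion_finset_le _ _
      _ ≤ D.card • (1 - c₀ * (ε / R)) ^ m := Finset.sum_le_card_nsmul _ _ _ hone
      _ ≤ (N.card : ℝ) ^ 2 * (1 - c₀ * (ε / R)) ^ m := by
          rw [nsmul_eq_mul]
          have : 0 ≤ (1 - c₀ * (ε / R)) ^ m := pow_nonneg (by linarith) m
          gcongr
      _ ≤ η := card_sq_mul_one_sub_pow_le hκ hK0 hc₀ hn hR hε hη hη1 hεR hr (Nat.cast_nonneg _)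
          hNcard le_rfl hle1 hm
  -- The `p i`, `q i` are only a.e. measurable, so `F` is replaced by a measurable superset of the
  -- same measure.
  refine ⟨(toMeasurable P F)ᶜ, (measurableSet_toMeasurable P F).compl, ?_, ?_⟩
  · rw [prob_compl_eq_one_sub (measurableSet_toMeasurable P F), measure_toMeasurable,
      ENNReal.ofReal_sub _ hη.le, ENNReal.ofReal_one]
    exact tsub_le_tsub_left ((ENNReal.le_ofReal_iff_toReal_le (measure_ne_top _ _) hη.le).2 hF) 1
  · intro ω hω x hx y hy hxy
    have hωF : ω ∉ F := fun h => hω (subset_toMeasurable P F h)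
    refine norm_sub_le_of_comparisons_eq hδ (N := N) hNcover (fun a ha b hb hab => ?_) tie hx hy hxy
    by_contra! hcon
    refine hωF (Set.mem_biUnion (x := (a, b)) ?_ hcon)
    simp only [D, Finset.coe_filter, Set.mem_ofPred_eq, Finset.mem_product]
    exact ⟨⟨ha, hb⟩, hab⟩
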